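/- Let $\Bbbk$ be an algebraically closed field with $\operatorname{char}\Bbbk\neq 2,3$ and let $n\ge 1$, $d\ge 1$. Let $V_{n,d}=\nu_d(\mathbb P^n)\subset\mathbb P^{N}$, $N=\binom{n+d}{n}-1$, be the Veronese variety, with homogeneous coordinates $z_I$ on $\mathbb P^N$ indexed by $I=(a_0,\dots,a_n)\in\mathbb N_0^{n+1}$ with $\sum_i a_i=d$, where $\nu_d([x])=[(x^I)_I]$. Then $(\mathbb P^n,\mathcal O_{\mathbb P^n}(d))$ satisfies property $\mathsf{QR}(3)$: the homogeneous ideal $I(V_{n,d})$ is generated by quadrics of rank at most $3$. More precisely, suppose $d\ge 2$. Let $f$ be the isomorphism from $H^0(\mathbb P^n,\mathcal O_{\mathbb P^n}(d))$ to the linear forms on $\mathbb P^N$ with $f(x^I)=z_I$, and for $s,t\in H^0(\mathbb P^n,\mathcal O_{\mathbb P^n}(1))$ and $h\in H^0(\mathbb P^n,\mathcal O_{\mathbb P^n}(d-2))$ put $$Q(s,t,h)=f(s^2h)\,f(t^2h)-f(sth)^2 .$$ Let $s_1,\dots,s_p$ be any basis of $H^0(\mathbb P^n,\mathcal O_{\mathbb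 P^n}(1))$, let $h_1,\dots,h_q$ be any basis of $H^0(\mathbb P^n,\mathcal O_{\mathbb P^n}(d-2))$, and let $H=\{h_i\}_{1\le i\le q}\cup\{h_i+h_j\mid 1\le i<j\le q\}$. Let $\Gamma=\Gamma(\mathcal O_{\mathbb P^n}(1),\mathcal O_{\mathbb P^n}(d-2))$ be the union of $$\begin{aligned} \Gamma_{11}&=\{Q(s_i,s_j,g)\mid i<j,\ g\in H\},\\ \Gamma_{12}&=\{Q(s_i+s_j,s_k,g)\mid i<j,\ k\neq i,j,\ g\in H\},\\ \Gamma_{22}&=\{Q(s_i+s_j,s_k+s_l,g)\mid i<j,\ k<l,\ i<k,\ j\neq k,l,\ g\in H\}. \end{aligned}$$ Then $\Gamma$ is a finite set of quadrics of rank $3$, and it generates the ideal $I(V_{n,d})$. -/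

import Mathlib

open scoped LinearAlgebra.Projectivization

namespace QuadricRank

noncomputable section

/-! ### Homogeneous ideals of projective sets, quadrics and their rank -/

/-- The homogeneous ideal `I(X)` of a subset `X` of the projective space with homogeneous
coordinates `z_i`, `i ∈ σ`: the ideal generated by the homogeneous polynomials that vanish at
(all representatives of) all points of `X`. -/
def homogeneousIdeal {k σ : Type*} [Field k] (X : Set (ℙ k (σ → k))) :
    Ideal (MvPolynomial σ k) :=
  Ideal.span {F | ∃ m : ℕ, F.IsHomogeneous m ∧
    ∀ (v : σ → k) (hv : v ≠ 0), Projectivization.mk k v hv ∈ X → MvPolynomial.eval v F = 0}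

/-- A quadric (quadratic equation): a nonzero homogeneous polynomial of degree two. -/
def IsQuadric {k σ : Type*} [Field k] (F : MvPolynomial σ k) : Prop :=
  F ≠ 0 ∧ F.IsHomogeneous 2

open scoped Classical in
/-- The symmetric matrix `M` of a quadratic form `F` in characteristic different from two,
`F(z) = ∑ i j, M i j * z i * z j`. -/
def gramMatrix {k σ : Type*} [Field k] (F : MvPolynomial σ k) : Matrix σ σ k :=
  Matrix.of fun i j =>
    if i = j then F.coeff (Finsupp.single i 2)
    else F.coeff (Finsupp.single i 1 + Finsupp.single j 1) / 2

/-- The rank of a quadric (in characteristic different from two): the rank of its symmetric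
matrix. -/
def quadricRank {k σ : Type*} [Field k] [Fintype σ] (F : MvPolynomial σ k) : ℕ :=
  (gramMatrix F).rank

/-- `X` satisfies property `QR(r)`: its homogeneous ideal can be generated by quadrics of rank at
most `r`. -/
def PropertyQR {k σ : Type*} [Field k] [Fintype σ] (r : ℕ) (X : Set (ℙ k (σ → k))) : Prop :=
  ∃ S : Set (MvPolynomial σ k),
    (∀ F ∈ S, IsQuadric F ∧ quadricRank F ≤ r) ∧ Ideal.span S = homogeneousIdeal X

/-! ### The Veronese embedding -/

/-- The set `A(n,d)` of exponent vectors `(a_0, …, a_n)` of natural numbers with sum `d`; it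
indexes the homogeneous coordinates `z_I` of the target of the `d`-th Veronese embedding. -/
abbrev Exponent (n d : ℕ) : Type :=
  {a : Fin (n + 1) →₀ ℕ // ∑ i, a i = d}

instance instFintypeExponent (n d : ℕ) : Fintype (Exponent n d) :=
  Fintype.subtype (Finset.finsuppAntidiag Finset.univ d) (by simp)

/-- The vector `(v^I)_I` of all monomials of degree `d` in the coordinates of `v`. -/
def veroneseVector (k : Type*) [Field k] (n d : ℕ) (v : Fin (n + 1) → k) : Exponent n d → k :=
  fun I => ∏ i, v i ^ (I.1 i)

theorem veroneseVector_ne_zero {k : Type*} [Field k] (n d : ℕ) (v : Fin (n + 1) → k)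
    (hv : v ≠ 0) : veroneseVector k n d v ≠ 0 := by
  obtain ⟨i, hi⟩ := Function.ne_iff.1 hv
  intro h
  have hsum : ∑ j, (Finsupp.single i d : Fin (n + 1) →₀ ℕ) j = d := by
    simp [Finsupp.single_apply]
  have h1 := congrFun h ⟨Finsupp.single i d, hsum⟩
  simp only [veroneseVector, Pi.zero_apply, Finset.prod_eq_zero_iff] at h1
  obtain ⟨j, -, hj⟩ := h1
  by_cases hji : i = j
  · subst hji
    exact hi (eq_zero_of_pow_eq_zero hj)
  · simp [hji] at hj

theorem veroneseVector_smul {k : Type*} [Field k] (n d : ℕ) (t : k) (v : Fin (n + 1) → k) :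
    veroneseVector k n d (t • v) = t ^ d • veroneseVector k n d v := by
  funext I
  simp only [veroneseVector, Pi.smul_apply, smul_eq_mul, mul_pow, Finset.prod_mul_distrib,
    Finset.prod_pow_eq_pow_sum, I.2]

/-- The `d`-th Veronese embedding `ν_d : ℙⁿ → ℙᴺ`, `[v] ↦ [(v^I)_I]`. -/
def veroneseMap (k : Type*) [Field k] (n d : ℕ) :
    ℙ k (Fin (n + 1) → k) → ℙ k (Exponent n d → k) :=
  Projectivization.lift
    (fun v => Projectivization.mk k (veroneseVector k n d v.1)
      (veroneseVector_ne_zero n d v.1 v.2))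
    (by
      intro a b t h
      rw [Projectivization.mk_eq_mk_iff']
      exact ⟨t ^ d, by rw [h, veroneseVector_smul]⟩)

/-- The Veronese variety `V_{n,d}`, the image of `ν_d`. -/
def veroneseVariety (k : Type*) [Field k] (n d : ℕ) : Set (ℙ k (Exponent n d → k)) :=
  Set.range (veroneseMap k n d)

/-! ### The map `Q` and the set `Γ` -/

/-- The space `H⁰(ℙⁿ, O(e))` of forms of degree `e` in `x_0, …, x_n`. -/
abbrev Forms (k : Type*) [Field k] (n e : ℕ) : Submodule k (MvPolynomial (Fin (n + 1)) k) :=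
  MvPolynomial.homogeneousSubmodule (Fin (n + 1)) k e

/-- The natural map `f` sending a form `F = ∑ c_I x^I` of degree `d` to the linear form
`∑ c_I z_I` on `ℙᴺ`. On `H⁰(ℙⁿ, O(d))` it is the isomorphism onto the linear forms, inverse to
restriction along `ν_d`; it is only applied to forms of degree `d`. -/
def linearForm {k : Type*} [Field k] (n d : ℕ) (F : MvPolynomial (Fin (n + 1)) k) :
    MvPolynomial (Exponent n d) k :=
  ∑ I : Exponent n d, MvPolynomial.C (F.coeff I.1) * MvPolynomial.X I

/-- `Q(s,t,h) = f(s²h) f(t²h) - f(sth)²`, for `s, t` of degree `1` and `h` of degree `d - 2`. -/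
def Q {k : Type*} [Field k] (n d : ℕ) (s t h : MvPolynomial (Fin (n + 1)) k) :
    MvPolynomial (Exponent n d) k :=
  linearForm n d (s * s * h) * linearForm n d (t * t * h) - linearForm n d (s * t * h) ^ 2

/-- The set `H = {h_i} ∪ {h_i + h_j | i < j}`. -/
def sumsOfBasis {R : Type*} [Add R] {q : ℕ} (h : Fin q → R) : Set R :=
  {g | ∃ i, g = h i} ∪ {g | ∃ i j, i < j ∧ g = h i + h j}

/-- `Γ₁₁ = {Q(s_i, s_j, g) | i < j, g ∈ H}`. -/
def Gamma11 {k : Type*} [Field k] (n d : ℕ) {p q : ℕ}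
    (s : Fin p → MvPolynomial (Fin (n + 1)) k) (h : Fin q → MvPolynomial (Fin (n + 1)) k) :
    Set (MvPolynomial (Exponent n d) k) :=
  {F | ∃ i j, i < j ∧ ∃ g ∈ sumsOfBasis h, F = Q n d (s i) (s j) g}

/-- `Γ₁₂ = {Q(s_i + s_j, s_l, g) | i < j, l ≠ i, j, g ∈ H}`. -/
def Gamma12 {k : Type*} [Field k] (n d : ℕ) {p q : ℕ}
    (s : Fin p → MvPolynomial (Fin (n + 1)) k) (h : Fin q → MvPolynomial (Fin (n + 1)) k) :
    Set (MvPolynomial (Exponent n d) k) :=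
  {F | ∃ i j l, i < j ∧ l ≠ i ∧ l ≠ j ∧ ∃ g ∈ sumsOfBasis h, F = Q n d (s i + s j) (s l) g}

/-- `Γ₂₂ = {Q(s_i + s_j, s_l + s_m, g) | i < j, l < m, i < l, j ≠ l, m, g ∈ H}`. -/
def Gamma22 {k : Type*} [Field k] (n d : ℕ) {p q : ℕ}
    (s : Fin p → MvPolynomial (Fin (n + 1)) k) (h : Fin q → MvPolynomial (Fin (n + 1)) k) :
    Set (MvPolynomial (Exponent n d) k) :=
  {F | ∃ i j l m, i < j ∧ l < m ∧ i < l ∧ j ≠ l ∧ j ≠ m ∧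
    ∃ g ∈ sumsOfBasis h, F = Q n d (s i + s j) (s l + s m) g}

/-- The set `Γ(O(1), O(d-2)) = Γ₁₁ ∪ Γ₁₂ ∪ Γ₂₂` attached to a basis `s` of `H⁰(ℙⁿ, O(1))` and a
basis `h` of `H⁰(ℙⁿ, O(d-2))`. -/
def Gamma {k : Type*} [Field k] (n d : ℕ) {p q : ℕ}
    (s : Module.Basis (Fin p) k (Forms k n 1)) (h : Module.Basis (Fin q) k (Forms k n (d - 2))) :
    Set (MvPolynomial (Exponent n d) k) :=
  Gamma11 n d (fun i => (s i).1) (fun i => (h i).1) ∪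
    Gamma12 n d (fun i => (s i).1) (fun i => (h i).1) ∪
    Gamma22 n d (fun i => (s i).1) (fun i => (h i).1)

end

end QuadricRank

/-! Generation. Work modulo the ideal spanned by `Γ`, with `f` the induced linear map. For fixed `g
∈ H` the matrix `y i j = f (s i * s j * g)` is symmetric, and its minors `R(a,b,c,d) = y a c * y b d
- y a d * y b c` have the symmetries of a curvature tensor. `Γ` kills the sectional curvatures on
the planes spanned by basis vectors or sums of two of them. Polarization and the Bianchi identity
then kill `R` after division by 2 and 3 (`minors_eq_of_sections`). The minors are quadratic in `g`,
so the sums in `H` polarize them, and multilinearity frees the relation from the chosen bases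
(`polarized_relation_of_sections`).

On monomials, set `E(u,v) = Y(x_a u) Y(x_b v) - Y(x_b u) Y(x_a v)` for `u, v` of degree `d - 1`.
This is antisymmetric, while the polarized relation says that it is unchanged when `u` and `v` trade
one variable. Trading all of them gives `E(u,v) = E(v,u) = -E(u,v)`, so `E = 0`
(`exchange_of_polarized`). These exchanges make a product of coordinates `z_I` depend only on its
total exponent (`prod_eq_of_sum_eq`). Hence the quotient map factors through `z_I ↦ x^I`, whose
kernel therefore lies in the span of `Γ`. The inclusions `(Γ) ⊆ I(V) ⊆ ker ⊆ (Γ)` close up.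

Rank. `Q(s,t,h)` is the conic `xz - y²` evaluated at the linear forms of `s²h`, `sth`, `t²h`, which
are linearly independent when `s, t` are and `h ≠ 0` (`quadricRank_Q`). -/

namespace QuadricRank

/-! ### Vanishing of curvature-like tensors -/

section Minors

variable {ι A : Type*} [LinearOrder ι] [CommRing A]

/-- A symmetric matrix whose "sectional curvatures" vanish on the planes spanned by
`e_i, e_j`, by `e_i + e_j, e_l` and by `e_i + e_j, e_l + e_m` has vanishing `2 × 2` minors. -/
theorem minors_eq_of_sections (two : ∀ x : A, 2 * x = 0 → x = 0)
    (three : ∀ x : A, 3 * x = 0 → x = 0) (y : ι → ι → A) (symm : ∀ i j, y i j = y j i)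
    (h11 : ∀ i j, i < j → y i i * y j j = y i j ^ 2)
    (h12 : ∀ i j l, i < j → l ≠ i → l ≠ j →
      (y i i + 2 * y i j + y j j) * y l l = (y i l + y j l) ^ 2)
    (h22 : ∀ i j l m, i < j → l < m → i < l → j ≠ l → j ≠ m →
      (y i i + 2 * y i j + y j j) * (y l l + 2 * y l m + y m m) =
        (y i l + y i m + y j l + y j m) ^ 2)
    (a b c d : ι) : y a c * y b d = y a d * y b c := by
  have e11 : ∀ i j, y i i * y j j = y i j ^ 2 := by
    intro i j
    rcases lt_trichotomy i j with h | rfl | h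
    · exact h11 i j h
    · ring
    · rw [symm i j, ← h11 j i h]; ring
  have e12 : ∀ i j l, y i j * y l l = y i l * y j l := by
    intro i j l
    by_cases hij : i = j
    · subst hij; rw [e11]; ring
    by_cases hli : l = i
    · subst hli; rw [symm l j]; ring
    by_cases hlj : l = j
    · subst hlj; ring
    have key : (y i i + 2 * y i j + y j j) * y l l = (y i l + y j l) ^ 2 := by
      rcases lt_or_gt_of_ne hij with h | h
      · exact h12 i j l h hli hlj
      · have := h12 j i l h hlj hli
        rw [symm j i] at this
        linear_combination this
    apply sub_eq_zero.1
    apply two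
    linear_combination key - e11 i l - e11 j l
  have e22 : ∀ i j l m, i ≠ j → l ≠ m → i ≠ l → i ≠ m → j ≠ l → j ≠ m →
      2 * (y i j * y l m) = y i l * y j m + y i m * y j l := by
    have ordered : ∀ i j l m, i < j → l < m → i < l → j ≠ l → j ≠ m →
        2 * (y i j * y l m) = y i l * y j m + y i m * y j l := by
      intro i j l m hij hlm hil hjl hjm
      -- In the expansion of `h22`, `e11` and `e12` cancel every term with a repeated index; twice
      -- the part multilinear in `i, j, l, m` remains.
      apply sub_eq_zero.1
      apply two
      have k1 := e12 i j l
      have k2 := e12 i j m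
      have k3 := e12 l m i
      have k4 := e12 l m j
      rw [symm l i, symm m i] at k3
      rw [symm l j, symm m j] at k4
      linear_combination h22 i j l m hij hlm hil hjl hjm - e11 i l - e11 i m - e11 j l - e11 j m
        - 2 * k1 - 2 * k2 - 2 * k3 - 2 * k4
    have half : ∀ i j l m, i < j → l < m → i ≠ l → i ≠ m → j ≠ l → j ≠ m →
        2 * (y i j * y l m) = y i l * y j m + y i m * y j l := by
      intro i j l m hij hlm hil him hjl hjm
      rcases lt_or_gt_of_ne hil with h | h
      · exact ordered i j l m hij hlm h hjl hjm
      · have := ordered l m i j hlm hij h him.symm hjm.symm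
        rw [symm l i, symm m j, symm l j, symm m i] at this
        linear_combination this
    intro i j l m hij hlm hil him hjl hjm
    rcases lt_or_gt_of_ne hij with h | h <;> rcases lt_or_gt_of_ne hlm with h' | h'
    · exact half i j l m h h' hil him hjl hjm
    · have := half i j m l h h' him hil hjm hjl
      rw [symm m l] at this
      linear_combination this
    · have := half j i l m h h' hjl hjm hil him
      rw [symm j i] at this
      linear_combination this
    · have := half j i m l h h' hjm hjl him hil
      rw [symm m l, symm j i] at this
      linear_combination this
  by_cases hab : a = b
  · subst hab; ring
  by_cases hcd : c = d
  · subst hcd; ring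
  by_cases hac : a = c
  · subst hac
    have := e12 b d a
    rw [symm d a] at this
    linear_combination this
  by_cases had : a = d
  · subst had
    have := e12 b c a
    rw [symm c a] at this
    linear_combination -this
  by_cases hbc : b = c
  · subst hbc
    have := e12 a d b
    rw [symm d b] at this
    linear_combination -this
  by_cases hbd : b = d
  · subst hbd
    have := e12 a c b
    rw [symm c b] at this
    linear_combination this
  -- Of the three products pairing `a, b, c, d`, these say that two are each the mean of the other
  -- two; subtracting gives three times the required difference.
  have k1 := e22 a c b d hac hbd hab had (Ne.symm hbc) hcd
  have k2 := e22 a d b c had hbc hab hac (Ne.symm hbd) (Ne.symm hcd)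
  rw [symm c d, symm c b] at k1
  rw [symm d c, symm d b] at k2
  apply sub_eq_zero.1
  apply three
  rw [symm c d] at k2
  linear_combination k1 - k2

end Minors

/-! ### Polarization -/

section Polarization

variable {k P A : Type*} [CommRing k] [CommRing P] [CommRing A] [Algebra k P] [Algebra k A]

/-- A relation that is linear in one element extends from a set to its span. -/
theorem mul_relation_of_mem_span (f : P →ₗ[k] A) {S : Set P} {x : P}
    (hx : x ∈ Submodule.span k S) (p₁ p₂ p₃ p₄ : P) (a₁ a₂ a₃ a₄ : A)
    (h : ∀ x ∈ S, f (x * p₁) * a₁ + f (x * p₂) * a₂ = f (x * p₃) * a₃ + f (x * p₄) * a₄) :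
    f (x * p₁) * a₁ + f (x * p₂) * a₂ = f (x * p₃) * a₃ + f (x * p₄) * a₄ := by
  induction hx using Submodule.span_induction with
  | mem x hx => exact h x hx
  | zero => simp
  | add x y _ _ hx hy =>
    simp only [add_mul, map_add]
    linear_combination hx + hy
  | smul c x _ hx =>
    simp only [smul_mul_assoc, map_smul, ← smul_add, hx]

/-- The polarized relation on a spanning set extends to all elements. -/
theorem polarized_relation_of_mem_span (f : P →ₗ[k] A) {S H : Set P}
    (rel : ∀ a ∈ S, ∀ b ∈ S, ∀ c ∈ S, ∀ d ∈ S, ∀ h ∈ H, ∀ h' ∈ H,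
      f (a * c * h) * f (b * d * h') + f (a * c * h') * f (b * d * h) =
        f (a * d * h) * f (b * c * h') + f (a * d * h') * f (b * c * h))
    {a b c d h h' : P} (ha : a ∈ Submodule.span k S) (hb : b ∈ Submodule.span k S)
    (hc : c ∈ Submodule.span k S) (hd : d ∈ Submodule.span k S)
    (hh : h ∈ Submodule.span k H) (hh' : h' ∈ Submodule.span k H) :
    f (a * c * h) * f (b * d * h') + f (a * c * h') * f (b * d * h) =
      f (a * d * h) * f (b * c * h') + f (a * d * h') * f (b * c * h) := by
  -- The relation is linear in each of its six arguments, which are released from the generating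
  -- sets one at a time.
  have ra : ∀ b ∈ S, ∀ c ∈ S, ∀ d ∈ S, ∀ h ∈ H, ∀ h' ∈ H,
      f (a * c * h) * f (b * d * h') + f (a * c * h') * f (b * d * h) =
        f (a * d * h) * f (b * c * h') + f (a * d * h') * f (b * c * h) := by
    intro b hb c hc d hd h hh h' hh'
    simp only [mul_assoc a]
    exact mul_relation_of_mem_span f ha _ _ _ _ _ _ _ _ fun x hx => by
      simpa only [mul_assoc] using rel x hx b hb c hc d hd h hh h' hh'
  have rb : ∀ c ∈ S, ∀ d ∈ S, ∀ h ∈ H, ∀ h' ∈ H,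
      f (a * c * h) * f (b * d * h') + f (a * c * h') * f (b * d * h) =
        f (a * d * h) * f (b * c * h') + f (a * d * h') * f (b * c * h) := by
    intro c hc d hd h hh h' hh'
    have := mul_relation_of_mem_span f hb (d * h') (d * h) (c * h') (c * h)
      (f (a * c * h)) (f (a * c * h')) (f (a * d * h)) (f (a * d * h')) fun x hx => by
        simp only [← mul_assoc x]
        linear_combination ra x hx c hc d hd h hh h' hh'
    simp only [← mul_assoc b] at this
    linear_combination this
  have rc : ∀ d ∈ S, ∀ h ∈ H, ∀ h' ∈ H,
      f (a * c * h) * f (b * d * h') + f (a * c * h') * f (b * d * h) =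
        f (a * d * h) * f (b * c * h') + f (a * d * h') * f (b * c * h) := by
    intro d hd h hh h' hh'
    have := mul_relation_of_mem_span f hc (a * h) (a * h') (b * h') (b * h)
      (f (b * d * h')) (f (b * d * h)) (f (a * d * h)) (f (a * d * h')) fun x hx => by
        simp only [← mul_assoc x, mul_comm x]
        linear_combination rb x hx d hd h hh h' hh'
    simp only [← mul_assoc c, mul_comm c] at this
    linear_combination this
  have rd : ∀ h ∈ H, ∀ h' ∈ H,
      f (a * c * h) * f (b * d * h') + f (a * c * h') * f (b * d * h) =
        f (a * d * h) * f (b * c * h') + f (a * d * h') * f (b * c * h) := by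
    intro h hh h' hh'
    have := mul_relation_of_mem_span f hd (b * h') (b * h) (a * h) (a * h')
      (f (a * c * h)) (f (a * c * h')) (f (b * c * h')) (f (b * c * h)) fun x hx => by
        simp only [← mul_assoc x, mul_comm x]
        linear_combination rc x hx h hh h' hh'
    simp only [← mul_assoc d, mul_comm d] at this
    linear_combination this
  have rh : ∀ h' ∈ H,
      f (a * c * h) * f (b * d * h') + f (a * c * h') * f (b * d * h) =
        f (a * d * h) * f (b * c * h') + f (a * d * h') * f (b * c * h) := by
    intro h' hh'
    have := mul_relation_of_mem_span f hh (a * c) (b * d) (a * d) (b * c)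
      (f (b * d * h')) (f (a * c * h')) (f (b * c * h')) (f (a * d * h')) fun x hx => by
        simp only [mul_comm x]
        linear_combination rd x hx h' hh'
    simp only [mul_comm h] at this
    linear_combination this
  have := mul_relation_of_mem_span f hh' (b * d) (a * c) (b * c) (a * d)
    (f (a * c * h)) (f (b * d * h)) (f (a * d * h)) (f (b * c * h)) fun x hx => by
      simp only [mul_comm x]
      linear_combination rh x hx
  simp only [mul_comm h'] at this
  linear_combination this

/-- The quadratic relations indexed by the planes of a basis and by the sums of a basis imply the
polarized relations. -/
theorem polarized_relation_of_sections (two : ∀ x : A, 2 * x = 0 → x = 0)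
    (three : ∀ x : A, 3 * x = 0 → x = 0) (f : P →ₗ[k] A) {p q : ℕ} (s : Fin p → P)
    (h : Fin q → P)
    (h11 : ∀ i j, i < j → ∀ g ∈ sumsOfBasis h,
      f (s i * s i * g) * f (s j * s j * g) = f (s i * s j * g) ^ 2)
    (h12 : ∀ i j l, i < j → l ≠ i → l ≠ j → ∀ g ∈ sumsOfBasis h,
      f ((s i + s j) * (s i + s j) * g) * f (s l * s l * g) = f ((s i + s j) * s l * g) ^ 2)
    (h22 : ∀ i j l m, i < j → l < m → i < l → j ≠ l → j ≠ m → ∀ g ∈ sumsOfBasis h,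
      f ((s i + s j) * (s i + s j) * g) * f ((s l + s m) * (s l + s m) * g) =
        f ((s i + s j) * (s l + s m) * g) ^ 2)
    {a b c d u v : P} (ha : a ∈ Submodule.span k (Set.range s))
    (hb : b ∈ Submodule.span k (Set.range s)) (hc : c ∈ Submodule.span k (Set.range s))
    (hd : d ∈ Submodule.span k (Set.range s)) (hu : u ∈ Submodule.span k (Set.range h))
    (hv : v ∈ Submodule.span k (Set.range h)) :
    f (a * c * u) * f (b * d * v) + f (a * c * v) * f (b * d * u) =
      f (a * d * u) * f (b * c * v) + f (a * d * v) * f (b * c * u) := by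
  have sq : ∀ x y g, f ((x + y) * (x + y) * g) =
      f (x * x * g) + 2 * f (x * y * g) + f (y * y * g) := by
    intro x y g
    rw [show (x + y) * (x + y) * g = x * x * g + (x * y * g + x * y * g) + y * y * g by ring]
    simp only [map_add]
    ring
  have minors : ∀ g ∈ sumsOfBasis h, ∀ a b c d,
      f (s a * s c * g) * f (s b * s d * g) = f (s a * s d * g) * f (s b * s c * g) := by
    intro g hg a b c d
    refine minors_eq_of_sections two three (fun i j => f (s i * s j * g))
      (fun i j => by rw [mul_comm (s i)]) (fun i j hij => h11 i j hij g hg) ?_ ?_ a b c d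
    · intro i j l hij hli hlj
      have := h12 i j l hij hli hlj g hg
      rwa [sq, add_mul (s i), add_mul (s i * s l), map_add] at this
    · intro i j l m hij hlm hil hjl hjm
      have := h22 i j l m hij hlm hil hjl hjm g hg
      rw [sq, sq, show (s i + s j) * (s l + s m) * g =
        s i * s l * g + s i * s m * g + s j * s l * g + s j * s m * g by ring] at this
      simpa only [map_add] using this
  refine polarized_relation_of_mem_span f ?_ ha hb hc hd hu hv
  rintro _ ⟨a, rfl⟩ _ ⟨b, rfl⟩ _ ⟨c, rfl⟩ _ ⟨d, rfl⟩ _ ⟨i, rfl⟩ _ ⟨j, rfl⟩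
  have single : ∀ i, h i ∈ sumsOfBasis h := fun i => Or.inl ⟨i, rfl⟩
  have ordered : ∀ i j, i < j →
      f (s a * s c * h i) * f (s b * s d * h j) + f (s a * s c * h j) * f (s b * s d * h i) =
      f (s a * s d * h i) * f (s b * s c * h j) + f (s a * s d * h j) * f (s b * s c * h i) := by
    intro i j hij
    -- The minor is quadratic in `g`: its value at `h i + h j` minus those at `h i` and `h j` is the
    -- mixed term.
    have := minors (h i + h j) (Or.inr ⟨i, j, hij, rfl⟩) a b c d
    simp only [mul_add, map_add] at this
    linear_combination this - minors (h i) (single i) a b c d - minors (h j) (single j) a b c d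
  rcases lt_trichotomy i j with hij | rfl | hij
  · exact ordered i j hij
  · linear_combination 2 * minors (h i) (single i) a b c d
  · linear_combination ordered j i hij

end Polarization

/-! ### From the polarized relations to the exchange relations -/

section Exchange

variable {ι A : Type*} [CommRing A]

/-- The polarized relations on monomials imply that one variable may be exchanged between the two
factors of a product. -/
theorem exchange_of_polarized (two : ∀ x : A, 2 * x = 0 → x = 0) (e : ℕ) (Y : (ι →₀ ℕ) → A)
    (rel : ∀ (a b c d : ι) (u v : ι →₀ ℕ), u.degree = e → v.degree = e →
      Y (.single a 1 + .single c 1 + u) * Y (.single b 1 + .single d 1 + v) +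
        Y (.single a 1 + .single c 1 + v) * Y (.single b 1 + .single d 1 + u) =
      Y (.single a 1 + .single d 1 + u) * Y (.single b 1 + .single c 1 + v) +
        Y (.single a 1 + .single d 1 + v) * Y (.single b 1 + .single c 1 + u))
    (a b : ι) (u v : ι →₀ ℕ) (hu : u.degree = e + 1) (hv : v.degree = e + 1) :
    Y (.single a 1 + u) * Y (.single b 1 + v) = Y (.single b 1 + u) * Y (.single a 1 + v) := by
  classical
  obtain ⟨E, hE⟩ : ∃ E : (ι →₀ ℕ) → (ι →₀ ℕ) → A, ∀ u v, E u v =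
      Y (.single a 1 + u) * Y (.single b 1 + v) - Y (.single b 1 + u) * Y (.single a 1 + v) :=
    ⟨_, fun _ _ => rfl⟩
  -- The polarized relation, with two terms moved across, is exactly the invariance of `E` under
  -- trading one variable.
  have swap_one : ∀ (c d : ι) (u v : ι →₀ ℕ), u.degree = e → v.degree = e →
      E (.single c 1 + u) (.single d 1 + v) = E (.single d 1 + u) (.single c 1 + v) := by
    intro c d u v hu hv
    simp only [hE, ← add_assoc]
    linear_combination rel a b c d u v hu hv
  have split : ∀ (r : ℕ) (u : ι →₀ ℕ), u.degree = r + 1 →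
      ∃ c u', u = .single c 1 + u' ∧ u'.degree = r := by
    intro r u hu
    have : u ≠ 0 := by rintro rfl; simp at hu
    obtain ⟨c, hc⟩ := Finsupp.ne_iff.1 this
    have hle : Finsupp.single c 1 ≤ u := by
      rw [Finsupp.single_le_iff]
      exact Nat.one_le_iff_ne_zero.2 hc
    obtain ⟨u', rfl⟩ := exists_add_of_le hle
    refine ⟨c, u', rfl, ?_⟩
    rw [map_add, Finsupp.degree_single] at hu
    omega
  have swap : ∀ (r : ℕ) (u v w w' : ι →₀ ℕ), u.degree = r → v.degree = r →
      r + w.degree = e + 1 → r + w'.degree = e + 1 → E (u + w) (v + w') = E (v + w) (u + w') := by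
    intro r
    induction r with
    | zero =>
      intro u v w w' hu hv _ _
      rw [(Finsupp.degree_eq_zero_iff u).1 hu, (Finsupp.degree_eq_zero_iff v).1 hv]
    | succ r ih =>
      intro u v w w' hu hv hw hw'
      obtain ⟨c, u, rfl, hu'⟩ := split r u hu
      obtain ⟨d, v, rfl, hv'⟩ := split r v hv
      -- Once traded, `d` and `c` are absorbed into the passive parts `w` and `w'`, and the
      -- induction trades the rest.
      rw [add_assoc, add_assoc, swap_one c d (u + w) (v + w') (by rw [map_add]; omega)
        (by rw [map_add]; omega), add_left_comm, add_left_comm _ v,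
        ih u v _ _ hu' hv' (by rw [map_add, Finsupp.degree_single]; omega)
          (by rw [map_add, Finsupp.degree_single]; omega)]
      congr 1 <;> abel
  have key := swap (e + 1) u v 0 0 hu hv (by simp) (by simp)
  simp only [add_zero, hE] at key
  apply sub_eq_zero.1
  apply two
  linear_combination key

end Exchange
/-! ### Straightening of monomials -/

section Straightening

variable {ι A : Type*} [CommRing A]

theorem exists_lt_of_degree_eq {u v : ι →₀ ℕ} (h : u.degree = v.degree) (hne : u ≠ v) :
    ∃ i, u i < v i := by
  by_contra! hle
  have hle : v ≤ u := hle
  obtain ⟨w, rfl⟩ := exists_add_of_le hle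
  rw [map_add, Nat.add_eq_left, Finsupp.degree_eq_zero_iff] at h
  exact hne (by rw [h, add_zero])

/-- Modulo the exchange relations, any exponent dividing a product of monomials of degree `d` can
be made one of its factors. -/
theorem exists_cons_of_le_sum {d : ℕ} (Y : (ι →₀ ℕ) → A)
    (exch : ∀ (a b : ι) (u v : ι →₀ ℕ), u.degree + 1 = d → v.degree + 1 = d →
      Y (.single a 1 + u) * Y (.single b 1 + v) = Y (.single b 1 + u) * Y (.single a 1 + v))
    (I : ι →₀ ℕ) (hI : I.degree = d) (J : ι →₀ ℕ) (M : Multiset (ι →₀ ℕ)) (hJ : J.degree = d)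
    (hM : ∀ K ∈ M, K.degree = d) (hle : I ≤ J + M.sum) :
    ∃ M' : Multiset (ι →₀ ℕ), (∀ K ∈ M', K.degree = d) ∧ I + M'.sum = J + M.sum ∧
      Y J * (M.map Y).prod = Y I * (M'.map Y).prod := by
  classical
  induction hr : (I - J).degree using Nat.strong_induction_on generalizing J M with
  | _ r ih =>
  by_cases hIJ : I = J
  · exact ⟨M, hM, by rw [hIJ], by rw [hIJ]⟩
  -- `J` has too few `i` and too many `j`. Some other factor `K` contains `i`; exchanging this `i`
  -- for a `j` of `J` brings `J` one step closer to `I`, as measured by the truncated difference `I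
  -- - J`.
  obtain ⟨i, hi⟩ := exists_lt_of_degree_eq (hJ.trans hI.symm) (Ne.symm hIJ)
  obtain ⟨j, hj⟩ := exists_lt_of_degree_eq (hI.trans hJ.symm) hIJ
  have hpos : (M.sum) i ≠ 0 := by
    have := hle i
    rw [Finsupp.add_apply] at this
    omega
  obtain ⟨K, hKM, hK⟩ : ∃ K ∈ M, K i ≠ 0 := by
    by_contra! hzero
    apply hpos
    rw [← Finsupp.applyAddHom_apply, map_multiset_sum]
    exact Multiset.sum_eq_zero fun x hx => by
      obtain ⟨K, hK, rfl⟩ := Multiset.mem_map.1 hx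
      exact hzero K hK
  obtain ⟨N, rfl⟩ := Multiset.exists_cons_of_mem hKM
  have hKi : Finsupp.single i 1 ≤ K := by rw [Finsupp.single_le_iff]; omega
  have hJj : Finsupp.single j 1 ≤ J := by rw [Finsupp.single_le_iff]; omega
  obtain ⟨u, rfl⟩ := exists_add_of_le hJj
  obtain ⟨v, rfl⟩ := exists_add_of_le hKi
  have hdu : u.degree + 1 = d := by rw [← hJ, map_add, Finsupp.degree_single]; omega
  have hdv : v.degree + 1 = d := by
    rw [← hM _ hKM, map_add, Finsupp.degree_single]; omega
  have hij : i ≠ j := by rintro rfl; omega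
  have hlt : (I - (.single i 1 + u)).degree < r := by
    have hsub : I - (.single j 1 + u) = .single i 1 + (I - (.single i 1 + u)) := by
      ext x
      have h1 : u i < I i := by simpa [hij.symm] using hi
      have h2 : I j < 1 + u j := by simpa using hj
      simp only [Finsupp.tsub_apply, Finsupp.add_apply, Finsupp.single_apply]
      split_ifs with h h' h'
      · exact absurd (h'.trans h.symm) hij
      · subst h; omega
      · subst h'; omega
      · omega
    rw [← hr, hsub, map_add, Finsupp.degree_single]
    omega
  have hsum : (.single i 1 + u) + ((.single j 1 + v) ::ₘ N).sum =
      (.single j 1 + u) + ((.single i 1 + v) ::ₘ N).sum := by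
    simp only [Multiset.sum_cons]
    abel
  obtain ⟨M', hM', hs, hp⟩ := ih _ hlt (.single i 1 + u) ((.single j 1 + v) ::ₘ N)
    (by rw [map_add, Finsupp.degree_single]; omega)
    (by
      intro L hL
      rcases Multiset.mem_cons.1 hL with rfl | hL
      · rw [map_add, Finsupp.degree_single]; omega
      · exact hM L (Multiset.mem_cons_of_mem hL))
    (by rwa [hsum]) rfl
  refine ⟨M', hM', hs.trans hsum, ?_⟩
  rw [← hp]
  simp only [Multiset.map_cons, Multiset.prod_cons]
  linear_combination (N.map Y).prod * exch j i u v hdu hdv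

/-- Modulo the exchange relations, a product of monomials of degree `d` depends only on the total
exponent. -/
theorem prod_eq_of_sum_eq {d : ℕ} (hd : 1 ≤ d) (Y : (ι →₀ ℕ) → A)
    (exch : ∀ (a b : ι) (u v : ι →₀ ℕ), u.degree + 1 = d → v.degree + 1 = d →
      Y (.single a 1 + u) * Y (.single b 1 + v) = Y (.single b 1 + u) * Y (.single a 1 + v))
    (M N : Multiset (ι →₀ ℕ)) (hM : ∀ K ∈ M, K.degree = d) (hN : ∀ K ∈ N, K.degree = d)
    (h : M.sum = N.sum) : (M.map Y).prod = (N.map Y).prod := by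
  -- Since `d ≥ 1`, a nonempty product cannot have the total exponent of the empty one.
  have ne_zero : ∀ (K : ι →₀ ℕ) (L : Multiset (ι →₀ ℕ)), K.degree = d → K + L.sum ≠ 0 := by
    intro K L hK h0
    have : (K + L.sum).degree = 0 := by rw [h0, map_zero]
    rw [map_add, hK] at this
    omega
  induction M using Multiset.induction_on generalizing N with
  | empty =>
    rcases Multiset.empty_or_exists_mem N with rfl | ⟨K, hK⟩
    · rfl
    · obtain ⟨N, rfl⟩ := Multiset.exists_cons_of_mem hK
      rw [Multiset.sum_zero, Multiset.sum_cons] at h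
      exact absurd h.symm (ne_zero K N (hN K hK))
  | cons I M ih =>
    have hI := hM I (Multiset.mem_cons_self I M)
    rw [Multiset.sum_cons] at h
    rcases Multiset.empty_or_exists_mem N with rfl | ⟨K, hK⟩
    · exact absurd h (ne_zero I M hI)
    obtain ⟨N, rfl⟩ := Multiset.exists_cons_of_mem hK
    rw [Multiset.sum_cons] at h
    obtain ⟨N', hN', hs, hp⟩ := exists_cons_of_le_sum Y exch I hI K N (hN K hK)
      (fun L hL => hN L (Multiset.mem_cons_of_mem hL)) (by rw [← h]; exact le_self_add)
    rw [Multiset.map_cons, Multiset.map_cons, Multiset.prod_cons, Multiset.prod_cons, hp,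
      ih N' (fun L hL => hM L (Multiset.mem_cons_of_mem hL)) hN'
        (add_left_cancel (h.trans hs.symm))]

end Straightening

/-! ### The kernel of restriction to the Veronese variety -/

section Kernel

open MvPolynomial

variable (k : Type*) [Field k] (n d : ℕ)

/-- The homomorphism `z_I ↦ x^I` of coordinate rings. -/
noncomputable def veroneseHom :
    MvPolynomial (Exponent n d) k →ₐ[k] MvPolynomial (Fin (n + 1)) k :=
  aeval fun I => monomial I.1 1

variable {k n d}

theorem degree_exponent (I : Exponent n d) : I.1.degree = d := by
  rw [Finsupp.degree_eq_sum, I.2]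

/-- Recasts monomials in the `z_I` as multisets of exponents, the language of straightening; it
serves both for `veroneseHom` and for the quotient map. -/
theorem map_monomial_eq {B : Type*} [CommRing B] [Algebra k B]
    (φ : MvPolynomial (Exponent n d) k →ₐ[k] B) (Y : (Fin (n + 1) →₀ ℕ) → B)
    (hY : ∀ I : Exponent n d, φ (X I) = Y I.1) (m : Exponent n d →₀ ℕ) (c : k) :
    φ (monomial m c) = c • ((m.toMultiset.map Subtype.val).map Y).prod := by
  rw [Multiset.map_map, Finsupp.toMultiset_map, Finsupp.prod_toMultiset,
    Finsupp.prod_mapDomain_index (by simp) (by intros; rw [pow_add]), monomial_eq, map_mul,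
    ← algebraMap_eq, AlgHom.commutes, Algebra.smul_def, Finsupp.prod, map_prod]
  simp [Finsupp.prod, hY]

theorem veroneseHom_monomial (m : Exponent n d →₀ ℕ) (c : k) :
    veroneseHom k n d (monomial m c) = monomial (m.toMultiset.map Subtype.val).sum c := by
  rw [map_monomial_eq _ (fun I => monomial I 1) (by simp [veroneseHom])]
  generalize m.toMultiset.map Subtype.val = M
  suffices h : (M.map fun I => monomial I (1 : k)).prod = monomial M.sum 1 by
    rw [h, smul_monomial, smul_eq_mul, mul_one]
  induction M using Multiset.induction_on with
  | empty => simp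
  | cons I M ih => simp [ih, monomial_mul]

/-- An ideal modulo which the exchange relations hold contains the toric ideal. -/
theorem ker_veroneseHom_le (hd : 1 ≤ d) (J : Ideal (MvPolynomial (Exponent n d) k))
    (Y : (Fin (n + 1) →₀ ℕ) → MvPolynomial (Exponent n d) k ⧸ J)
    (hY : ∀ I : Exponent n d, Ideal.Quotient.mk J (X I) = Y I.1)
    (exch : ∀ (a b : Fin (n + 1)) (u v : Fin (n + 1) →₀ ℕ), u.degree + 1 = d → v.degree + 1 = d →
      Y (.single a 1 + u) * Y (.single b 1 + v) = Y (.single b 1 + u) * Y (.single a 1 + v)) :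
    RingHom.ker (veroneseHom k n d) ≤ J := by
  classical
  -- `T e` is the common class of all products with total exponent `e`. The default `0` is harmless:
  -- only exponents of monomials in the image of `veroneseHom` matter.
  let T : (Fin (n + 1) →₀ ℕ) → MvPolynomial (Exponent n d) k ⧸ J := fun e =>
    if h : ∃ M : Multiset (Fin (n + 1) →₀ ℕ), (∀ K ∈ M, K.degree = d) ∧ M.sum = e then
      (h.choose.map Y).prod else 0
  have hT : ∀ M : Multiset (Fin (n + 1) →₀ ℕ), (∀ K ∈ M, K.degree = d) →
      T M.sum = (M.map Y).prod := by
    intro M hM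
    have h : ∃ N : Multiset (Fin (n + 1) →₀ ℕ), (∀ K ∈ N, K.degree = d) ∧ N.sum = M.sum :=
      ⟨M, hM, rfl⟩
    simp only [T, dif_pos h]
    exact prod_eq_of_sum_eq hd Y exch _ _ h.choose_spec.1 hM h.choose_spec.2
  -- Linearity of `L` suffices to factor the quotient map through `veroneseHom`; multiplicativity is
  -- not needed.
  let L := (basisMonomials (Fin (n + 1)) k).constr k T
  have hL : ∀ F, Ideal.Quotient.mkₐ k J F = L (veroneseHom k n d F) := by
    intro F
    induction F using MvPolynomial.induction_on' with
    | monomial m c =>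
      rw [veroneseHom_monomial, map_monomial_eq (Ideal.Quotient.mkₐ k J) Y hY, ← hT]
      · have : (monomial (m.toMultiset.map Subtype.val).sum c : MvPolynomial (Fin (n + 1)) k) =
            c • basisMonomials (Fin (n + 1)) k (m.toMultiset.map Subtype.val).sum := by
          simp [smul_monomial]
        rw [this, map_smul, Module.Basis.constr_basis]
      · intro K hK
        obtain ⟨I, -, rfl⟩ := Multiset.mem_map.1 hK
        exact degree_exponent I
    | add p q hp hq => rw [map_add, map_add, map_add, hp, hq]
  intro F hF
  rw [← Ideal.Quotient.eq_zero_iff_mem, ← Ideal.Quotient.mkₐ_eq_mk k, hL, hF, map_zero]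

theorem eval_veroneseVector (v : Fin (n + 1) → k) (F : MvPolynomial (Exponent n d) k) :
    eval (veroneseVector k n d v) F = eval v (veroneseHom k n d F) := by
  induction F using MvPolynomial.induction_on with
  | C a => simp [veroneseHom]
  | add p q hp hq => simp [hp, hq]
  | mul_X p I hp =>
    simp [hp, veroneseHom, veroneseVector, eval_monomial, Finsupp.prod_fintype]

theorem mk_veroneseVector_mem (v : Fin (n + 1) → k) (hv : v ≠ 0) :
    Projectivization.mk k (veroneseVector k n d v) (veroneseVector_ne_zero n d v hv) ∈
      veroneseVariety k n d :=
  ⟨Projectivization.mk k v hv, by rw [veroneseMap, Projectivization.lift_mk]⟩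

theorem exists_smul_of_mem_veroneseVariety (w : Exponent n d → k) (hw : w ≠ 0)
    (h : Projectivization.mk k w hw ∈ veroneseVariety k n d) :
    ∃ (c : k) (v : Fin (n + 1) → k), w = c • veroneseVector k n d v := by
  obtain ⟨P, hP⟩ := h
  induction P using Projectivization.ind with
  | h v hv =>
    rw [veroneseMap, Projectivization.lift_mk, eq_comm, Projectivization.mk_eq_mk_iff'] at hP
    obtain ⟨c, hc⟩ := hP
    exact ⟨c, v, hc.symm⟩

theorem homogeneousIdeal_veroneseVariety_le [Infinite k] :
    homogeneousIdeal (veroneseVariety k n d) ≤ RingHom.ker (veroneseHom k n d) := by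
  refine Ideal.span_le.2 ?_
  rintro F ⟨m, -, hF⟩
  -- Vanishing is known only at nonzero `v`; the factor `X 0` takes care of the origin and is then
  -- cancelled in the domain.
  have : X 0 * veroneseHom k n d F = 0 := by
    apply MvPolynomial.funext
    intro v
    by_cases hv : v = 0
    · simp [hv]
    · rw [map_mul, ← eval_veroneseVector,
        hF _ (veroneseVector_ne_zero n d v hv) (mk_veroneseVector_mem v hv), mul_zero, map_zero]
  exact (mul_eq_zero.1 this).resolve_left (X_ne_zero 0)

end Kernel

/-! ### Linear forms and the quadrics `Q(s, t, h)` -/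

section LinearForm

open MvPolynomial

variable {k : Type*} [Field k] {n d : ℕ}

/-- The map `linearForm` as a linear map. -/
noncomputable def linearFormMap (k : Type*) [Field k] (n d : ℕ) :
    MvPolynomial (Fin (n + 1)) k →ₗ[k] MvPolynomial (Exponent n d) k where
  toFun := linearForm n d
  map_add' F G := by simp [linearForm, add_mul, Finset.sum_add_distrib]
  map_smul' c F := by simp [linearForm, mul_assoc, Finset.smul_sum, smul_eq_C_mul]

theorem linearFormMap_apply (F : MvPolynomial (Fin (n + 1)) k) :
    linearFormMap k n d F = linearForm n d F := rfl

theorem linearForm_monomial (I : Exponent n d) :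
    linearForm n d (monomial I.1 (1 : k)) = X I := by
  classical
  rw [linearForm, Finset.sum_eq_single I]
  · simp
  · intro J _ hJ
    rw [coeff_monomial, if_neg (fun h => hJ (Subtype.ext h.symm)), C_0, zero_mul]
  · simp

theorem isHomogeneous_linearForm (F : MvPolynomial (Fin (n + 1)) k) :
    (linearForm n d F).IsHomogeneous 1 :=
  IsHomogeneous.sum _ _ _ fun I _ => by
    simpa using (isHomogeneous_C (Exponent n d) (F.coeff I.1)).mul (isHomogeneous_X k I)

theorem eval_smul_linearForm (c : k) (w : Exponent n d → k) (F : MvPolynomial (Fin (n + 1)) k) :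
    eval (c • w) (linearForm n d F) = c * eval w (linearForm n d F) := by
  simp [linearForm, Finset.mul_sum, mul_left_comm]

theorem isHomogeneous_Q (s t h : MvPolynomial (Fin (n + 1)) k) :
    (Q n d s t h).IsHomogeneous 2 :=
  ((isHomogeneous_linearForm _).mul (isHomogeneous_linearForm _)).sub
    ((isHomogeneous_linearForm _).pow 2)

theorem veroneseHom_linearForm {F : MvPolynomial (Fin (n + 1)) k} (hF : F.IsHomogeneous d) :
    veroneseHom k n d (linearForm n d F) = F := by
  classical
  ext e
  simp only [linearForm, map_sum, map_mul, veroneseHom, aeval_C, aeval_X, algebraMap_eq,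
    coeff_sum, coeff_C_mul, coeff_monomial]
  by_cases he : e.degree = d
  · rw [Finset.sum_eq_single ⟨e, by rwa [← Finsupp.degree_eq_sum]⟩]
    · simp
    · intro I _ hI
      rw [if_neg (fun h => hI (Subtype.ext h)), mul_zero]
    · simp
  · rw [hF.coeff_eq_zero he]
    refine Finset.sum_eq_zero fun I _ => ?_
    rw [if_neg, mul_zero]
    rintro rfl
    exact he (degree_exponent I)

theorem isHomogeneous_mul_mul (hd : 2 ≤ d) {s t h : MvPolynomial (Fin (n + 1)) k}
    (hs : s.IsHomogeneous 1) (ht : t.IsHomogeneous 1) (hh : h.IsHomogeneous (d - 2)) :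
    (s * t * h).IsHomogeneous d := by
  have := (hs.mul ht).mul hh
  rwa [show 1 + 1 + (d - 2) = d by omega] at this

theorem Q_mem_homogeneousIdeal {s t h : MvPolynomial (Fin (n + 1)) k}
    (hs : s.IsHomogeneous 1) (ht : t.IsHomogeneous 1) (hd : 2 ≤ d)
    (hh : h.IsHomogeneous (d - 2)) :
    Q n d s t h ∈ homogeneousIdeal (veroneseVariety k n d) := by
  refine Ideal.subset_span ⟨2, isHomogeneous_Q s t h, fun w hw hmem => ?_⟩
  obtain ⟨c, v, rfl⟩ := exists_smul_of_mem_veroneseVariety w hw hmem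
  have hker : veroneseHom k n d (Q n d s t h) = 0 := by
    rw [Q, map_sub, map_mul, map_pow, veroneseHom_linearForm (isHomogeneous_mul_mul hd hs hs hh),
      veroneseHom_linearForm (isHomogeneous_mul_mul hd ht ht hh),
      veroneseHom_linearForm (isHomogeneous_mul_mul hd hs ht hh)]
    ring
  -- A representative of a point of the variety is only a scalar multiple of a Veronese vector.
  have hscale : eval (c • veroneseVector k n d v) (Q n d s t h) =
      c ^ 2 * eval (veroneseVector k n d v) (Q n d s t h) := by
    simp only [Q, map_sub, map_mul, map_pow, eval_smul_linearForm]
    ring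
  rw [hscale, eval_veroneseVector, hker, map_zero, mul_zero]

end LinearForm
/-! ### The rank of `Q(s, t, h)` -/

section Rank

open MvPolynomial

variable {k : Type*} [Field k] {n d : ℕ}

theorem coeff_linearForm_mul_linearForm [DecidableEq (Exponent n d)]
    (F G : MvPolynomial (Fin (n + 1)) k) (I J : Exponent n d) :
    coeff (Finsupp.single I 1 + Finsupp.single J 1) (linearForm n d F * linearForm n d G) =
      if I = J then F.coeff I.1 * G.coeff I.1
      else F.coeff I.1 * G.coeff J.1 + F.coeff J.1 * G.coeff I.1 := by
  classical
  have term : ∀ K L : Exponent n d,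
      coeff (Finsupp.single I 1 + Finsupp.single J 1)
        (C (F.coeff K.1) * X K * (C (G.coeff L.1) * X L)) =
      if K = I ∧ L = J ∨ K = J ∧ L = I then F.coeff K.1 * G.coeff L.1 else 0 := by
    intro K L
    rw [C_mul_X_eq_monomial, C_mul_X_eq_monomial, monomial_mul, coeff_monomial]
    refine if_congr ?_ rfl rfl
    rw [Finsupp.single_add_single_eq_single_add_single one_ne_zero one_ne_zero]
    simp
  simp only [linearForm, Finset.sum_mul_sum, coeff_sum, term]
  split_ifs with hIJ
  · subst hIJ
    simp only [or_self, ite_and]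
    simp
  · have split : ∀ K L : Exponent n d,
        (if K = I ∧ L = J ∨ K = J ∧ L = I then F.coeff K.1 * G.coeff L.1 else 0) =
        (if K = I then if L = J then F.coeff K.1 * G.coeff L.1 else 0 else 0) +
        (if K = J then if L = I then F.coeff K.1 * G.coeff L.1 else 0 else 0) := by
      intro K L
      by_cases h1 : K = I
      · subst h1
        simp [hIJ]
      · simp [h1, ite_and]
    simp only [split, Finset.sum_add_distrib]
    simp

/-- The matrix of the ternary form `x z - y²`. -/
def conicMatrix (k : Type*) [Field k] : Matrix (Fin 3) (Fin 3) k :=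
  !![0, 0, 2⁻¹; 0, -1, 0; 2⁻¹, 0, 0]

theorem rank_conicMatrix (h2 : (2 : k) ≠ 0) : (conicMatrix k).rank = 3 := by
  rw [Matrix.rank_of_isUnit, Fintype.card_fin]
  rw [Matrix.isUnit_iff_isUnit_det, isUnit_iff_ne_zero, conicMatrix, Matrix.det_fin_three]
  simp [h2]

theorem gramMatrix_conic (h2 : (2 : k) ≠ 0) (F G H : MvPolynomial (Fin (n + 1)) k) :
    gramMatrix (linearForm n d F * linearForm n d G - linearForm n d H ^ 2) =
      (Matrix.of ![fun I : Exponent n d => F.coeff I.1, fun I => H.coeff I.1,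
        fun I => G.coeff I.1]).transpose * (conicMatrix k *
      Matrix.of ![fun I : Exponent n d => F.coeff I.1, fun I => H.coeff I.1,
        fun I => G.coeff I.1]) := by
  classical
  ext I J
  have hsq : (Finsupp.single I 2 : Exponent n d →₀ ℕ) = .single I 1 + .single I 1 := by
    rw [← Finsupp.single_add]
  simp only [gramMatrix, Matrix.of_apply, pow_two, coeff_sub, hsq,
    coeff_linearForm_mul_linearForm, Matrix.mul_apply, Fin.sum_univ_three, conicMatrix]
  by_cases hIJ : I = J
  · subst hIJ
    simp
    field_simp
    ring
  · simp [hIJ]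
    field_simp
    ring

/-- Independent rows give `P` a right inverse `R`, so `B` is recovered as `Rᵀ (Pᵀ B P) R`, and
neither rank can exceed the other. -/
theorem rank_transpose_mul_mul {σ τ : Type*} [Fintype σ] [Fintype τ]
    (P : Matrix τ σ k) (B : Matrix τ τ k) (hP : LinearIndependent k P.row) :
    (P.transpose * (B * P)).rank = B.rank := by
  classical
  obtain ⟨R, hR⟩ : ∃ R : Matrix σ τ k, P * R = 1 := by
    rw [← Matrix.mulVec_surjective_iff_exists_right_inverse]
    have hrank := hP.rank_matrix
    rw [Matrix.rank] at hrank
    have := Submodule.eq_top_of_finrank_eq (hrank.trans (Module.finrank_fintype_fun_eq_card k).symm)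
    exact LinearMap.range_eq_top.1 this
  apply le_antisymm
  · exact (Matrix.rank_mul_le_right _ _).trans (Matrix.rank_mul_le_left _ _)
  · have : B = R.transpose * (P.transpose * (B * P) * R) := by
      rw [Matrix.mul_assoc, Matrix.mul_assoc B, hR, Matrix.mul_one, ← Matrix.mul_assoc,
        ← Matrix.transpose_mul, hR, Matrix.transpose_one, Matrix.one_mul]
    calc B.rank = (R.transpose * (P.transpose * (B * P) * R)).rank := by rw [← this]
      _ ≤ _ := (Matrix.rank_mul_le_right _ _).trans (Matrix.rank_mul_le_left _ _)

/-- Over an algebraically closed field the products `s²`, `st`, `t²` of two linearly independent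
elements of a domain are linearly independent. -/
theorem quadratic_relation_trivial [IsAlgClosed k] (h2 : (2 : k) ≠ 0) {P : Type*} [CommRing P]
    [IsDomain P] [Algebra k P] {s t : P} (hst : LinearIndependent k ![s, t]) (a b c : k)
    (h : a • (s * s) + b • (s * t) + c • (t * t) = 0) : a = 0 ∧ b = 0 ∧ c = 0 := by
  rw [LinearIndependent.pair_iff] at hst
  have ha : a = 0 := by
    by_contra ha
    have : NeZero (2 : k) := ⟨h2⟩
    obtain ⟨r, hr⟩ := IsAlgClosed.exists_pow_nat_eq (discrim a b c) two_pos
    obtain ⟨x, hx⟩ := exists_quadratic_eq_zero ha ⟨r, by rw [← hr, pow_two]⟩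
    have hx' : algebraMap k P a * (algebraMap k P x * algebraMap k P x) +
        algebraMap k P b * algebraMap k P x + algebraMap k P c = 0 := by
      simp only [← map_mul, ← map_add, hx, map_zero]
    -- The binary form splits at its root `x`; neither factor can vanish, because their coefficients
    -- of `s` are `1` and `a`.
    have key : ((1 : k) • s + (-x) • t) * (a • s + (b + a * x) • t) = 0 := by
      simp only [Algebra.smul_def, map_one, map_neg, map_add, map_mul] at h ⊢
      linear_combination h - t * t * hx'
    rcases mul_eq_zero.1 key with h | h
    · exact one_ne_zero (hst _ _ h).1
    · exact ha (hst _ _ h).1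
  subst ha
  have key : (b • s + c • t) * t = 0 := by
    simpa [add_mul] using h
  have ht : t ≠ 0 := by
    rintro rfl
    exact one_ne_zero (hst 0 1 (by simp)).2
  obtain ⟨hb, hc⟩ := hst _ _ ((mul_eq_zero.1 key).resolve_right ht)
  exact ⟨rfl, hb, hc⟩

theorem eq_zero_of_coeff_exponent {F : MvPolynomial (Fin (n + 1)) k} (hF : F.IsHomogeneous d)
    (h : ∀ I : Exponent n d, F.coeff I.1 = 0) : F = 0 := by
  ext e
  by_cases he : e.degree = d
  · exact h ⟨e, by rwa [← Finsupp.degree_eq_sum]⟩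
  · exact hF.coeff_eq_zero he

theorem quadricRank_Q [IsAlgClosed k] (h2 : (2 : k) ≠ 0) (hd : 2 ≤ d)
    {s t h : MvPolynomial (Fin (n + 1)) k} (hs : s.IsHomogeneous 1) (ht : t.IsHomogeneous 1)
    (hh : h.IsHomogeneous (d - 2)) (hst : LinearIndependent k ![s, t]) (h0 : h ≠ 0) :
    quadricRank (Q n d s t h) = 3 := by
  rw [quadricRank, Q, gramMatrix_conic h2, rank_transpose_mul_mul, rank_conicMatrix h2]
  rw [Fintype.linearIndependent_iff]
  intro c hc
  have hF : c 0 • (s * s * h) + c 1 • (s * t * h) + c 2 • (t * t * h) = 0 := by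
    refine eq_zero_of_coeff_exponent (d := d) ?_ fun I => ?_
    · refine ((homogeneousSubmodule (Fin (n + 1)) k d).add_mem
        (Submodule.add_mem _ (Submodule.smul_mem _ _ ?_) (Submodule.smul_mem _ _ ?_))
        (Submodule.smul_mem _ _ ?_) :)
      · exact isHomogeneous_mul_mul hd hs hs hh
      · exact isHomogeneous_mul_mul hd hs ht hh
      · exact isHomogeneous_mul_mul hd ht ht hh
    · simpa [Fin.sum_univ_three, Matrix.row] using congrFun hc I
  have hq : c 0 • (s * s) + c 1 • (s * t) + c 2 • (t * t) = 0 := by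
    refine ((mul_eq_zero (b := h)).1 ?_).resolve_right h0
    simpa only [add_mul, smul_mul_assoc] using hF
  obtain ⟨h0, h1, h2⟩ := quadratic_relation_trivial h2 hst _ _ _ hq
  intro i
  fin_cases i
  exacts [h0, h1, h2]

/-- Nonvanishing comes from the rank: the zero polynomial would have rank 0, not 3. -/
theorem isQuadric_Q [IsAlgClosed k] (h2 : (2 : k) ≠ 0) (hd : 2 ≤ d)
    {s t h : MvPolynomial (Fin (n + 1)) k} (hs : s.IsHomogeneous 1) (ht : t.IsHomogeneous 1)
    (hh : h.IsHomogeneous (d - 2)) (hst : LinearIndependent k ![s, t]) (h0 : h ≠ 0) :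
    IsQuadric (Q n d s t h) := by
  refine ⟨fun hQ => ?_, isHomogeneous_Q s t h⟩
  have hrank := quadricRank_Q h2 hd hs ht hh hst h0
  have hzero : gramMatrix (0 : MvPolynomial (Exponent n d) k) = 0 := by
    ext I J
    simp [gramMatrix]
  rw [hQ, quadricRank, hzero, Matrix.rank_zero] at hrank
  omega

end Rank

/-! ### The set `Γ` -/

section GammaSet

open MvPolynomial

variable {k : Type*} [Field k] {n d : ℕ}

theorem finite_sumsOfBasis {R : Type*} [Add R] {q : ℕ} (h : Fin q → R) :
    (sumsOfBasis h).Finite := by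
  refine ((Set.finite_range h).union
    (Set.finite_range fun x : Fin q × Fin q => h x.1 + h x.2)).subset ?_
  rintro g (⟨i, rfl⟩ | ⟨i, j, -, rfl⟩)
  · exact Or.inl ⟨i, rfl⟩
  · exact Or.inr ⟨(i, j), rfl⟩

/-- Every element of `Γ` is `Q(s, t, g)` for linearly independent sums `s, t` and `g ∈ H`. -/
theorem exists_eq_Q_of_mem_Gamma {p q : ℕ} (s : Module.Basis (Fin p) k (Forms k n 1))
    (h : Module.Basis (Fin q) k (Forms k n (d - 2))) {F : MvPolynomial (Exponent n d) k}
    (hF : F ∈ Gamma n d s h) :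
    ∃ a ∈ Set.range (fun i => s i) ∪ Set.range (fun x : Fin p × Fin p => s x.1 + s x.2),
    ∃ b ∈ Set.range (fun i => s i) ∪ Set.range (fun x : Fin p × Fin p => s x.1 + s x.2),
    ∃ g ∈ sumsOfBasis (fun i => h i), LinearIndependent k ![a, b] ∧
      F = Q n d a.1 b.1 g.1 := by
  have lift : ∀ g ∈ sumsOfBasis (fun i => (h i).1), ∃ g' ∈ sumsOfBasis (fun i => h i),
      g = g'.1 := by
    rintro g (⟨i, rfl⟩ | ⟨i, j, hij, rfl⟩)
    · exact ⟨h i, Or.inl ⟨i, rfl⟩, rfl⟩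
    · exact ⟨h i + h j, Or.inr ⟨i, j, hij, rfl⟩, rfl⟩
  have hs := s.linearIndependent
  have indep : ∀ a b : Forms k n 1, (∀ x y : k, x • a + y • b = 0 → x = 0 ∧ y = 0) →
      LinearIndependent k ![a, b] := fun a b => LinearIndependent.pair_iff.2
  rcases hF with (⟨i, j, hij, g, hg, rfl⟩ | ⟨i, j, l, hij, hli, hlj, g, hg, rfl⟩) |
    ⟨i, j, l, m, hij, hlm, hil, hjl, hjm, g, hg, rfl⟩ <;> obtain ⟨g, hg', rfl⟩ := lift g hg
  · refine ⟨s i, Or.inl ⟨i, rfl⟩, s j, Or.inl ⟨j, rfl⟩, g, hg', indep _ _ fun x y hxy => ?_, rfl⟩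
    have hx := congrArg (fun v => s.repr v i) hxy
    have hy := congrArg (fun v => s.repr v j) hxy
    simp [hij.ne, hij.ne'] at hx hy
    exact ⟨hx, hy⟩
  · refine ⟨s i + s j, Or.inr ⟨(i, j), rfl⟩, s l, Or.inl ⟨l, rfl⟩, g, hg',
      indep _ _ fun x y hxy => ?_, rfl⟩
    have hx := congrArg (fun v => s.repr v i) hxy
    have hy := congrArg (fun v => s.repr v l) hxy
    simp [hij.ne', hli, hli.symm, hlj.symm] at hx hy
    exact ⟨hx, hy⟩
  · refine ⟨s i + s j, Or.inr ⟨(i, j), rfl⟩, s l + s m, Or.inr ⟨(l, m), rfl⟩, g, hg',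
      indep _ _ fun x y hxy => ?_, rfl⟩
    -- Coordinate `i` sees only the first sum, since `i < l < m`; coordinate `l` sees only the
    -- second, since `l ≠ i, j`.
    have hx := congrArg (fun v => s.repr v i) hxy
    have hy := congrArg (fun v => s.repr v l) hxy
    simp [hij.ne', hil.ne, hil.ne', hlm.ne', hjl, (hil.trans hlm).ne'] at hx hy
    exact ⟨hx, hy⟩

theorem finite_Gamma {p q : ℕ} (s : Module.Basis (Fin p) k (Forms k n 1))
    (h : Module.Basis (Fin q) k (Forms k n (d - 2))) : (Gamma n d s h).Finite := by
  set S := Set.range (fun i => s i) ∪ Set.range (fun x : Fin p × Fin p => s x.1 + s x.2) with hS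
  have fS : S.Finite := (Set.finite_range _).union (Set.finite_range _)
  refine ((fS.prod (fS.prod (finite_sumsOfBasis fun i => h i))).image
    fun x => Q n d x.1.1 x.2.1.1 x.2.2.1).subset fun F hF => ?_
  obtain ⟨a, ha, b, hb, g, hg, -, rfl⟩ := exists_eq_Q_of_mem_Gamma s h hF
  exact ⟨(a, b, g), ⟨ha, hb, hg⟩, rfl⟩

theorem ne_zero_of_mem_sumsOfBasis {V : Type*} [AddCommGroup V] [Module k V] {q : ℕ}
    (h : Module.Basis (Fin q) k V) {g : V} (hg : g ∈ sumsOfBasis (fun i => h i)) : g ≠ 0 := by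
  rcases hg with ⟨i, rfl⟩ | ⟨i, j, hij, rfl⟩
  · exact h.ne_zero i
  · intro h0
    have := congrArg (fun v => h.repr v i) h0
    simp [hij.ne'] at this

theorem rank_three_of_mem_Gamma [IsAlgClosed k] (h2 : (2 : k) ≠ 0) (hd : 2 ≤ d) {p q : ℕ}
    (s : Module.Basis (Fin p) k (Forms k n 1)) (h : Module.Basis (Fin q) k (Forms k n (d - 2)))
    {F : MvPolynomial (Exponent n d) k} (hF : F ∈ Gamma n d s h) :
    IsQuadric F ∧ quadricRank F = 3 := by
  obtain ⟨a, -, b, -, g, hg, hab, rfl⟩ := exists_eq_Q_of_mem_Gamma s h hF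
  have hg0 : g.1 ≠ 0 := fun h0 => ne_zero_of_mem_sumsOfBasis h hg (Subtype.ext h0)
  have hab' : LinearIndependent k ![a.1, b.1] := by
    rw [LinearIndependent.pair_iff] at hab ⊢
    exact fun x y hxy => hab x y (Subtype.ext hxy)
  exact ⟨isQuadric_Q h2 hd a.2 b.2 g.2 hab' hg0, quadricRank_Q h2 hd a.2 b.2 g.2 hab' hg0⟩

theorem mem_span_range_basis {V : Type*} [AddCommGroup V] [Module k V] {W : Submodule k V}
    {ι : Type*} (b : Module.Basis ι k W) {v : V} (hv : v ∈ W) :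
    v ∈ Submodule.span k (Set.range fun i => (b i).1) := by
  have : (⟨v, hv⟩ : W) ∈ Submodule.span k (Set.range b) := by rw [b.span_eq]; trivial
  have := Submodule.mem_map_of_mem (f := W.subtype) this
  rwa [Submodule.map_span, ← Set.range_comp] at this

theorem ker_veroneseHom_le_span_Gamma (h2 : (2 : k) ≠ 0) (h3 : (3 : k) ≠ 0) (hd : 2 ≤ d)
    {p q : ℕ} (s : Module.Basis (Fin p) k (Forms k n 1))
    (h : Module.Basis (Fin q) k (Forms k n (d - 2))) :
    RingHom.ker (veroneseHom k n d) ≤ Ideal.span (Gamma n d s h) := by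
  set J := Ideal.span (Gamma n d s h) with hJ
  -- The quotient is a `k`-vector space, so it has no 2- or 3-torsion, whatever `J` is.
  have cancel : ∀ c : k, c ≠ 0 → ∀ x : MvPolynomial (Exponent n d) k ⧸ J,
      algebraMap k _ c * x = 0 → x = 0 := by
    intro c hc x hx
    rw [← Algebra.smul_def] at hx
    exact (smul_eq_zero.1 hx).resolve_left hc
  have two : ∀ x : MvPolynomial (Exponent n d) k ⧸ J, 2 * x = 0 → x = 0 := by
    simpa only [map_ofNat] using cancel 2 h2
  have three : ∀ x : MvPolynomial (Exponent n d) k ⧸ J, 3 * x = 0 → x = 0 := by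
    simpa only [map_ofNat] using cancel 3 h3
  let f : MvPolynomial (Fin (n + 1)) k →ₗ[k] MvPolynomial (Exponent n d) k ⧸ J :=
    (Ideal.Quotient.mkₐ k J).toLinearMap ∘ₗ linearFormMap k n d
  have rel : ∀ a b g, Q n d a b g ∈ Gamma n d s h →
      f (a * a * g) * f (b * b * g) = f (a * b * g) ^ 2 := by
    intro a b g hQ
    have := Ideal.Quotient.eq_zero_iff_mem.2 (Ideal.subset_span hQ)
    rw [Q, map_sub, map_mul, map_pow] at this
    exact sub_eq_zero.1 this
  -- The arbitrary bases are left behind here: variables and monomials lie in their spans.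
  have polar := fun (a b c d' : Fin (n + 1)) (u v : Fin (n + 1) →₀ ℕ) (hu : u.degree = d - 2)
      (hv : v.degree = d - 2) =>
    polarized_relation_of_sections two three f (fun i => (s i).1) (fun i => (h i).1)
      (fun i j hij g hg => rel _ _ _ (Or.inl (Or.inl ⟨i, j, hij, g, hg, rfl⟩)))
      (fun i j l hij hli hlj g hg =>
        rel _ _ _ (Or.inl (Or.inr ⟨i, j, l, hij, hli, hlj, g, hg, rfl⟩)))
      (fun i j l m hij hlm hil hjl hjm g hg =>
        rel _ _ _ (Or.inr ⟨i, j, l, m, hij, hlm, hil, hjl, hjm, g, hg, rfl⟩))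
      (mem_span_range_basis s (isHomogeneous_X k a)) (mem_span_range_basis s (isHomogeneous_X k b))
      (mem_span_range_basis s (isHomogeneous_X k c)) (mem_span_range_basis s (isHomogeneous_X k d'))
      (mem_span_range_basis h (isHomogeneous_monomial 1 hu))
      (mem_span_range_basis h (isHomogeneous_monomial 1 hv))
  refine ker_veroneseHom_le (by omega) J (fun e => f (monomial e 1)) (fun I => ?_) ?_
  · simp only [f, LinearMap.comp_apply, linearFormMap_apply, linearForm_monomial]
    rfl
  · intro a b u v hu hv
    refine exchange_of_polarized two (d - 2) (fun e => f (monomial e 1)) ?_ a b u v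
      (by omega) (by omega)
    intro a b c d' u v hu hv
    have := polar a b c d' u v hu hv
    simpa only [X, monomial_mul, one_mul] using this

theorem span_Gamma_eq [Infinite k] (h2 : (2 : k) ≠ 0) (h3 : (3 : k) ≠ 0) (hd : 2 ≤ d)
    {p q : ℕ} (s : Module.Basis (Fin p) k (Forms k n 1))
    (h : Module.Basis (Fin q) k (Forms k n (d - 2))) :
    Ideal.span (Gamma n d s h) = homogeneousIdeal (veroneseVariety k n d) := by
  apply le_antisymm
  · refine Ideal.span_le.2 fun F hF => ?_
    obtain ⟨a, -, b, -, g, -, -, rfl⟩ := exists_eq_Q_of_mem_Gamma s h hF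
    exact Q_mem_homogeneousIdeal a.2 b.2 hd g.2
  · exact homogeneousIdeal_veroneseVariety_le.trans (ker_veroneseHom_le_span_Gamma h2 h3 hd s h)

theorem finite_forms (k : Type*) [Field k] (n e : ℕ) : Module.Finite k (Forms k n e) := by
  let c : Forms k n e →ₗ[k] (Exponent n e → k) :=
    LinearMap.pi fun I => lcoeff k I.1 ∘ₗ (Forms k n e).subtype
  refine Module.Finite.of_injective c ?_
  rw [injective_iff_map_eq_zero]
  exact fun F hF => Subtype.ext (eq_zero_of_coeff_exponent F.2 fun I => congrFun hF I)

/-- For `d = 1` the exponents `u, v` are zero and the exchange relation is mere commutativity, so it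
already holds modulo the zero ideal. -/
theorem homogeneousIdeal_veroneseVariety_one [Infinite k] :
    homogeneousIdeal (veroneseVariety k n 1) = ⊥ := by
  refine le_bot_iff.1 (homogeneousIdeal_veroneseVariety_le.trans ?_)
  refine ker_veroneseHom_le le_rfl ⊥
    (fun e => Ideal.Quotient.mk ⊥ (linearForm n 1 (monomial e 1)))
    (fun I => by rw [linearForm_monomial]) fun a b u v hu hv => ?_
  rw [(Finsupp.degree_eq_zero_iff u).1 (by omega), (Finsupp.degree_eq_zero_iff v).1 (by omega),
    mul_comm]

theorem propertyQR_veroneseVariety [IsAlgClosed k] (h2 : (2 : k) ≠ 0) (h3 : (3 : k) ≠ 0)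
    (hd : 1 ≤ d) : PropertyQR 3 (veroneseVariety k n d) := by
  rcases hd.eq_or_lt with rfl | hd
  · exact ⟨∅, by simp, by rw [homogeneousIdeal_veroneseVariety_one, Ideal.span_empty]⟩
  · have := finite_forms k n 1
    have := finite_forms k n (d - 2)
    let s := Module.finBasis k (Forms k n 1)
    let h := Module.finBasis k (Forms k n (d - 2))
    refine ⟨Gamma n d s h, fun F hF => ?_, span_Gamma_eq h2 h3 hd s h⟩
    have := rank_three_of_mem_Gamma h2 hd s h hF
    exact ⟨this.1, this.2.le⟩

end GammaSet
end QuadricRank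

theorem theorem1p1 {k : Type*} [Field k] [IsAlgClosed k]
    (h2 : ringChar k ≠ 2) (h3 : ringChar k ≠ 3) (n d : ℕ) (hn : 1 ≤ n) (hd : 1 ≤ d) :
    QuadricRank.PropertyQR 3 (QuadricRank.veroneseVariety k n d) ∧
    (2 ≤ d → ∀ {p q : ℕ} (s : Module.Basis (Fin p) k (QuadricRank.Forms k n 1))
      (h : Module.Basis (Fin q) k (QuadricRank.Forms k n (d - 2))),
      (QuadricRank.Gamma n d s h).Finite ∧
      (∀ F ∈ QuadricRank.Gamma n d s h,
        QuadricRank.IsQuadric F ∧ QuadricRank.quadricRank F = 3) ∧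
      Ideal.span (QuadricRank.Gamma n d s h) =
        QuadricRank.homogeneousIdeal (QuadricRank.veroneseVariety k n d)) := by
  have two : (2 : k) ≠ 0 := Ring.two_ne_zero h2
  have three : (3 : k) ≠ 0 := by
    intro h0
    have hdvd : ringChar k ∣ 3 := ringChar.dvd (by exact_mod_cast h0)
    rcases (Nat.dvd_prime Nat.prime_three).1 hdvd with h | h
    · exact CharP.ringChar_ne_one h
    · exact h3 h
  exact ⟨QuadricRank.propertyQR_veroneseVariety two three hd, fun hd _ _ s h =>
    ⟨QuadricRank.finite_Gamma s h, fun F hF => QuadricRank.rank_three_of_mem_Gamma two hd s h hF,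
      QuadricRank.span_Gamma_eq two three hd s h⟩⟩
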